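/- All groups are finite. For a finite group \(G\), let \(\mathrm{Irr}(G)\) be the set of its irreducible complex characters and \(\mathrm{Cl}(G)\) the set of its conjugacy classes; the character table of \(G\) is the matrix \((\chi(C))_{\chi\in\mathrm{Irr}(G),\,C\in\mathrm{Cl}(G)}\). For \(N\trianglelefteq G\), let \(\mathrm{Lin}_G(N)\) be the set of those \(\theta\in\mathrm{Irr}(N)\) with \(\theta(1)=1\) that are \(G\)-invariant, i.e. \(\theta(gng^{-1})=\theta(n)\) for all \(g\in G\), \(n\in N\). For \(\theta\in\mathrm{Irr}(N)\), let \(\mathrm{Irr}(G|\theta)\) be the set of \(\chi\in\mathrm{Irr}(G)\) whose restriction to \(N\) has \(\theta\) as a constituent. The lower central \(G\)-series of \(N\) is given by \(\Gamma_G^1(N)=N\), \(\Gamma_G^{i+1}(N)=[\Gamma_G^i(N),G]\); \(N\) is called hypercentral in \(G\) if \(\Gamma_G^r(N)=1\) for some \(r\). The upper central \(G\)-series of \(N\) is given by \(\mathbf Z_G^0(N)=1\) and \(\mathbf Z_G^{i+1}(N)/\mathbf Z_G^i(N)=\mathbf Z(G/\mathbf Z_G^i(N))\cap N/\mathbf Z_G^i(N)\),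 and the \(G\)-hypercentre of \(N\) is \(H_G(N)=\bigcup_i \mathbf Z_G^i(N)\). **Corollary.** Let \(N\trianglelefteq G\). The character table of \(G\) (with the columns contained in \(N\) marked) determines the subgroup \([N,G]\), the sets \(\mathrm{Irr}(G|\theta)\) for \(\theta\in\mathrm{Lin}_G(N)\), the \(G\)-hypercentre of \(N\), whether \(N\) is hypercentral in \(G\) and, if it is, the lower central \(G\)-series of \(N\). Precisely: let \(G'\) be a finite group and let \(\beta:\mathrm{Irr}(G)\to\mathrm{Irr}(G')\) and \(\alpha:\mathrm{Cl}(G)\to\mathrm{Cl}(G')\) be bijections with \(\beta(\chi)(\alpha(C))=\chi(C)\) for all \(\chi\in\mathrm{Irr}(G)\) and \(C\in\mathrm{Cl}(G)\). For \(S\subseteq G\), let \(S^\alpha\subseteq G'\) be the union of the classes \(\alpha(C)\), where \(C\) runs over the classes of \(G\) that meet \(S\). Then \(N'=N^\alpha\) is a normal subgroup of \(G'\), and 1. \([N,G]^\alpha=[N',G']\); 2. there is a bijection \(\tau:\mathrm{Lin}_G(N)\to\mathrm{Lin}_{G'}(N')\) such that \(\beta(\mathrm{Irr}(G|\theta))=\mathrm{Irr}(G'|\tau(\theta))\)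 for all \(\theta\in\mathrm{Lin}_G(N)\); 3. \(H_G(N)^\alpha=H_{G'}(N')\); 4. \(N\) is hypercentral in \(G\) if and only if \(N'\) is hypercentral in \(G'\), and in that case \(\Gamma_G^i(N)^\alpha=\Gamma_{G'}^i(N')\) for all \(i\ge 1\). -/

import Mathlib

namespace CharTable

/-- The set of irreducible complex characters of `G`, as functions on `G`.  Every
finite-dimensional complex representation is isomorphic to one on some `Fin n → ℂ`. -/
def Irr (G : Type*) [Group G] : Set (G → ℂ) :=
  {χ | ∃ (n : ℕ) (ρ : Representation ℂ G (Fin n → ℂ)), ρ.IsIrreducible ∧ ρ.character = χ}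

theorem Irr.eq_of_isConj {G : Type*} [Group G] (χ : Irr G) (a b : G) (h : IsConj a b) :
    χ.1 a = χ.1 b := by
  obtain ⟨χ, n, ρ, -, rfl⟩ := χ
  obtain ⟨c, rfl⟩ := isConj_iff.1 h
  exact (ρ.char_conj a c).symm

/-- The character table of `G`: rows are indexed by the irreducible characters, columns by the
conjugacy classes, and the entry at `(χ, g^G)` is `χ g`. -/
def charTable (G : Type*) [Group G] : Matrix (Irr G) (ConjClasses G) ℂ :=
  fun χ c => Quotient.lift χ.1 (Irr.eq_of_isConj χ) c

/-- `G` and `G'` have the same character table: a bijection of rows and a bijection of columns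
that carry one table to the other. -/
structure TableEquiv (G G' : Type*) [Group G] [Group G'] where
  row : Irr G ≃ Irr G'
  col : ConjClasses G ≃ ConjClasses G'
  entry_eq : ∀ χ c, charTable G' (row χ) (col c) = charTable G χ c

/-- The union of the conjugacy classes of `G'` whose columns match the columns of the classes of
the elements of `S`. -/
def TableEquiv.transport {G G' : Type*} [Group G] [Group G'] (T : TableEquiv G G') (S : Set G) :
    Set G' :=
  {g' | ∃ g ∈ S, T.col (ConjClasses.mk g) = ConjClasses.mk g'}

/-- The usual inner product `[φ, ψ] = |H|⁻¹ ∑ φ(h) conj(ψ(h))` of complex functions on a finite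
group. -/
noncomputable def charInner {H : Type*} [Group H] [Finite H] (φ ψ : H → ℂ) : ℂ :=
  letI := Fintype.ofFinite H
  (Nat.card H : ℂ)⁻¹ * ∑ h : H, φ h * (starRingEnd ℂ) (ψ h)

section NormalSubgroup

variable {G : Type*} [Group G] (N : Subgroup G)

/-- The linear (degree one) `G`-invariant irreducible characters of the normal subgroup `N`. -/
def LinInv [N.Normal] : Set (N → ℂ) :=
  {θ | θ ∈ Irr N ∧ θ 1 = 1 ∧ ∀ (g : G) (n : N), θ (MulAut.conjNormal g n) = θ n}

/-- `Irr(G|θ)`: the irreducible characters of `G` whose restriction to `N` has `θ` as a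
constituent. -/
def irrOver [Finite G] (θ : N → ℂ) : Set (Irr G) :=
  {χ | charInner (fun n : N => χ.1 (n : G)) θ ≠ 0}

/-- The lower central `G`-series of `N`, with indices starting at `0`: its terms are
`N`, `[N, G]`, `[[N, G], G]`, and so on. -/
def lowerSeries : ℕ → Subgroup G
  | 0 => N
  | i + 1 => ⁅lowerSeries i, (⊤ : Subgroup G)⁆

/-- `N` is hypercentral in `G`: its lower central `G`-series reaches the trivial subgroup. -/
def IsHypercentral : Prop :=
  ∃ r : ℕ, lowerSeries N r = ⊥

/-- The upper central `G`-series of `N`, bundled with normality of its terms: it starts at the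
trivial subgroup, and `Z (i + 1)` is the intersection with `N` of the preimage in `G` of the
centre of `G / Z i`. -/
def upperSeriesAux [hN : N.Normal] : ℕ → {Z : Subgroup G // Z.Normal}
  | 0 => ⟨⊥, inferInstance⟩
  | i + 1 =>
    let Z := upperSeriesAux i
    haveI := Z.2
    ⟨(Subgroup.center (G ⧸ Z.1)).comap (QuotientGroup.mk' Z.1) ⊓ N, inferInstance⟩

/-- The upper central `G`-series of the normal subgroup `N`. -/
def upperSeries [N.Normal] (i : ℕ) : Subgroup G :=
  (upperSeriesAux N i).1

/-- The `G`-hypercentre of `N`: the union of the (ascending) upper central `G`-series of `N`. -/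
def hypercentre [N.Normal] : Subgroup G :=
  ⨆ i : ℕ, upperSeries N i

end NormalSubgroup

end CharTable

/-! Everything is read off from two facts about an irreducible character χ afforded by ρ. Values of
ρ have finite order, so `|χ(g)| ≤ χ(1)`, with equality exactly when `ρ g` is scalar, and `χ(g) =
χ(1)` exactly when `ρ g = 1`. Hence the table shows the kernels and, as each normal subgroup is an
intersection of kernels (`mem_iff_forall_ker`), all normal subgroups.

By Schur's lemma, `[N,G] ≤ ker χ` iff N acts by scalars, that is, iff `|χ| = χ(1)` on N
(`commutator_le_ker_iff`). So the table gives `[N,G]`, and `TableEquiv.map` is an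
inclusion-preserving bijection of normal subgroups that commutes with `[·,G]`. Both central series
are described by inclusion and `[·,G]` alone, hence are carried along.

For θ linear and invariant, χ lies over θ iff `χ = χ(1)θ` on N (`mem_irrOver_iff`). Thus θ is
recovered from any one χ over it, and matching rows give τ. -/

/-! ### Traces of endomorphisms of finite order -/

open Module in
theorem Module.End.norm_eq_one_of_mem_roots_charpoly {V : Type*} [AddCommGroup V] [Module ℂ V]
    [FiniteDimensional ℂ V] {A : End ℂ V} {m : ℕ} (hm : m ≠ 0) (hA : A ^ m = 1) {z : ℂ}
    (hz : z ∈ A.charpoly.roots) : ‖z‖ = 1 := by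
  have hev : A.HasEigenvalue z :=
    (A.hasEigenvalue_iff_isRoot_charpoly z).2 (Polynomial.isRoot_of_mem_roots hz)
  obtain ⟨v, hv⟩ := hev.exists_hasEigenvector
  have h := hv.pow_apply m
  rw [hA, End.one_apply] at h
  have h2 : (z ^ m - 1) • v = 0 := by rw [sub_smul, one_smul, ← h, sub_self]
  exact Complex.norm_eq_one_of_pow_eq_one
    (sub_eq_zero.1 ((smul_eq_zero.1 h2).resolve_right hv.2)) hm

open Module in
theorem Module.End.trace_eq_sum_roots_charpoly_complex {V : Type*} [AddCommGroup V] [Module ℂ V]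
    [FiniteDimensional ℂ V] (A : End ℂ V) : LinearMap.trace ℂ V A = A.charpoly.roots.sum :=
  End.trace_eq_sum_roots_charpoly_of_splits (IsAlgClosed.splits _)

open Module in
theorem Module.End.card_roots_charpoly_complex {V : Type*} [AddCommGroup V] [Module ℂ V]
    [FiniteDimensional ℂ V] (A : End ℂ V) : A.charpoly.roots.card = finrank ℂ V := by
  rw [← (IsAlgClosed.splits A.charpoly).natDegree_eq_card_roots, LinearMap.charpoly_natDegree]

theorem Multiset.norm_sum_le_card {s : Multiset ℂ} (hs : ∀ z ∈ s, ‖z‖ = 1) :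
    ‖s.sum‖ ≤ s.card := by
  refine (norm_multiset_sum_le s).trans_eq ?_
  rw [Multiset.map_congr rfl hs]
  simp

/-- Equality in the triangle inequality for complex numbers of norm one. -/
theorem Multiset.exists_eq_of_norm_sum_eq_card {s : Multiset ℂ} (hs : ∀ z ∈ s, ‖z‖ = 1)
    (h : ‖s.sum‖ = s.card) : ∃ c, ∀ z ∈ s, z = c := by
  induction s using Multiset.induction_on with
  | empty => exact ⟨0, by simp⟩
  | cons a s ih =>
    have ha : ‖a‖ = 1 := hs a (by simp)
    have hs' : ∀ z ∈ s, ‖z‖ = 1 := fun z hz ↦ hs z (by simp [hz])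
    rw [Multiset.sum_cons, Multiset.card_cons] at h
    push_cast at h
    have h1 := Multiset.norm_sum_le_card hs'
    have h2 := norm_add_le a s.sum
    have h3 : ‖s.sum‖ = s.card := by linarith
    obtain ⟨c, hc⟩ := ih hs' h3
    refine ⟨a, fun z hz ↦ ?_⟩
    rcases Multiset.mem_cons.1 hz with rfl | hz
    · rfl
    have hzc := hc z hz
    subst hzc
    have hsum : s.sum = s.card • z := by
      conv_lhs => rw [Multiset.eq_replicate_card.2 hc, Multiset.sum_replicate]
    have hpos : 0 < s.card := Multiset.card_pos_iff_exists_mem.2 ⟨z, hz⟩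
    -- Equality in the triangle inequality puts `a` on the ray of `s.sum`, a positive multiple of
    -- `z`; equal norms then give `a = z`.
    have h4 : ‖a + s.sum‖ = ‖a‖ + ‖s.sum‖ := by linarith
    have h5 : SameRay ℝ a s.sum := sameRay_iff_norm_add.2 h4
    have h6 : SameRay ℝ a z := by
      rw [hsum] at h5
      have : SameRay ℝ (s.card • z) z := SameRay.sameRay_nonneg_smul_left z (Nat.zero_le s.card)
      refine h5.trans this ?_
      intro h0
      have hz1 := hs' z hz
      rw [smul_eq_zero] at h0
      rcases h0 with h0 | h0
      · omega
      · simp [h0] at hz1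
    exact (h6.eq_of_norm_eq (ha.trans (hs' z hz).symm)).symm

open Module in
theorem Module.End.norm_trace_le_finrank {V : Type*} [AddCommGroup V] [Module ℂ V]
    [FiniteDimensional ℂ V] {A : End ℂ V} {m : ℕ} (hm : m ≠ 0) (hA : A ^ m = 1) :
    ‖LinearMap.trace ℂ V A‖ ≤ finrank ℂ V := by
  rw [A.trace_eq_sum_roots_charpoly_complex, ← A.card_roots_charpoly_complex]
  exact Multiset.norm_sum_le_card fun z hz ↦ norm_eq_one_of_mem_roots_charpoly hm hA hz

open Module in
/-- An endomorphism of finite order whose trace has the largest possible norm is a scalar. -/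
theorem Module.End.eq_smul_one_of_norm_trace_eq {V : Type*} [AddCommGroup V] [Module ℂ V]
    [FiniteDimensional ℂ V] {A : End ℂ V} {m : ℕ} (hm : m ≠ 0) (hA : A ^ m = 1)
    (h : ‖LinearMap.trace ℂ V A‖ = finrank ℂ V) : ∃ c : ℂ, A = c • 1 := by
  rw [A.trace_eq_sum_roots_charpoly_complex, ← A.card_roots_charpoly_complex] at h
  obtain ⟨c, hc⟩ := Multiset.exists_eq_of_norm_sum_eq_card
    (fun z hz ↦ norm_eq_one_of_mem_roots_charpoly hm hA hz) h
  refine ⟨c, ?_⟩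
  -- `A` is a root of the separable polynomial `X ^ m - 1`, hence semisimple; its only eigenvalue is
  -- `c`, so `A - c` is both nilpotent and semisimple, hence zero.
  have hsf : Squarefree (minpoly ℂ A) := by
    have hsep : (Polynomial.X ^ m - 1 : Polynomial ℂ).Separable :=
      Polynomial.separable_X_pow_sub_C_unit (1 : ℂˣ) (isUnit_iff_ne_zero.2 (by exact_mod_cast hm))
    refine Squarefree.squarefree_of_dvd ?_ hsep.squarefree
    exact minpoly.dvd ℂ A (by simp [hA])
  have hnil : IsNilpotent (A - c • 1) := by
    have hcp : A.charpoly = (Polynomial.X - Polynomial.C c) ^ A.charpoly.roots.card := by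
      conv_lhs => rw [(IsAlgClosed.splits A.charpoly).eq_prod_roots_of_monic A.charpoly_monic,
        Multiset.eq_replicate_card.2 hc]
      simp
    refine ⟨A.charpoly.roots.card, ?_⟩
    have := LinearMap.aeval_self_charpoly A
    rw [hcp] at this
    simpa [Algebra.algebraMap_eq_smul_one] using this
  have hss : (A - c • 1 : End ℂ V).IsSemisimple := by
    have h1 : A.IsSemisimple := isSemisimple_of_squarefree_aeval_eq_zero hsf (minpoly.aeval ℂ A)
    have := (End.isSemisimple_sub_algebraMap_iff (f := A) (μ := c)).2 h1
    rwa [Algebra.algebraMap_eq_smul_one] at this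
  exact sub_eq_zero.1 (End.eq_zero_of_isNilpotent_isSemisimple hnil hss)

/-! ### Schur's lemma and separation by irreducible representations -/

namespace Representation

open scoped MonoidAlgebra

variable {G : Type*} [Group G]

/-- **Schur's lemma** in terms of commuting endomorphisms. -/
theorem IsIrreducible.exists_eq_smul_one {V : Type*} [AddCommGroup V] [Module ℂ V]
    [FiniteDimensional ℂ V] {ρ : Representation ℂ G V} (hρ : ρ.IsIrreducible)
    (f : Module.End ℂ V) (hf : ∀ g, Commute f (ρ g)) : ∃ c : ℂ, f = c • 1 := by
  let F : IntertwiningMap ρ ρ := ⟨f, fun g ↦ hf g⟩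
  obtain ⟨c, hc⟩ := (IsIrreducible.algebraMap_intertwiningMap_bijective_of_isAlgClosed
    (ρ := ρ)).2 F
  refine ⟨c, LinearMap.ext fun v ↦ ?_⟩
  exact (DFunLike.congr_fun hc v).symm

/-- A simple module over the group algebra of a finite group is the module of an irreducible
representation in coordinates. -/
theorem exists_isIrreducible_of_isSimpleModule [Finite G] {M : Type*} [AddCommGroup M]
    [Module ℂ M] [Module ℂ[G] M] [IsScalarTower ℂ ℂ[G] M] [IsSimpleModule ℂ[G] M] {a : ℂ[G]}
    {m : M} (ha : a • m ≠ 0) :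
    ∃ (n : ℕ) (ρ : Representation ℂ G (Fin n → ℂ)), ρ.IsIrreducible ∧ ρ.asAlgebraHom a ≠ 0 := by
  have : Module.Finite ℂ M := Module.Finite.trans ℂ[G] M
  let e := (Module.finBasis ℂ M).equivFun
  let Φ : ℂ[G] →ₐ[ℂ] Module.End ℂ (Fin (Module.finrank ℂ M) → ℂ) :=
    ((e.conjAlgEquiv ℂ : _ ≃ₐ[ℂ] _) : _ →ₐ[ℂ] _).comp (Algebra.lsmul ℂ ℂ M)
  let ρ : Representation ℂ G (Fin (Module.finrank ℂ M) → ℂ) :=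
    (MonoidAlgebra.lift ℂ _ G).symm Φ
  have hρ : ρ.asAlgebraHom = Φ := (MonoidAlgebra.lift ℂ _ G).apply_symm_apply Φ
  have key (x : ℂ[G]) (v : M) : e (x • v) = ρ.asAlgebraHom x (e v) := by
    simp [hρ, Φ, LinearEquiv.conjAlgEquiv_apply]
  refine ⟨_, ρ, ?_, fun h ↦ ha (e.injective ?_)⟩
  · rw [irreducible_iff_isSimpleModule_asModule]
    let E : M ≃ₗ[ℂ[G]] ρ.asModule :=
      { e.toAddEquiv.trans ρ.asModuleEquiv.symm.toAddEquiv with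
        map_smul' := fun x v ↦ key x v }
    exact IsSimpleModule.congr E.symm
  · rw [key, h, LinearMap.zero_apply, map_zero]

/-- The irreducible representations of a finite group separate the elements of its group
algebra. -/
theorem exists_isIrreducible_asAlgebraHom_ne_zero [Finite G] {a : ℂ[G]} (ha : a ≠ 0) :
    ∃ (n : ℕ) (ρ : Representation ℂ G (Fin n → ℂ)), ρ.IsIrreducible ∧ ρ.asAlgebraHom a ≠ 0 := by
  have : NeZero (Nat.card G : ℂ) := ⟨by exact_mod_cast Nat.card_pos.ne'⟩
  -- By Maschke's theorem the radical vanishes, so some maximal left ideal `I` misses `a`, and `a`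
  -- moves the class of 1 in the simple quotient to a nonzero element.
  have h1 : a ∉ Ring.jacobson ℂ[G] := by
    rw [IsSemisimpleRing.jacobson_eq_bot]
    exact ha
  obtain ⟨I, hI, haI⟩ : ∃ I : Submodule ℂ[G] ℂ[G], IsCoatom I ∧ a ∉ I := by
    simpa [Ring.jacobson, Module.jacobson, Submodule.mem_sInf] using h1
  have hs : IsSimpleModule ℂ[G] (ℂ[G] ⧸ I) := isSimpleModule_iff_isCoatom.2 hI
  refine exists_isIrreducible_of_isSimpleModule (M := ℂ[G] ⧸ I) (a := a)
    (m := Submodule.Quotient.mk 1) ?_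
  rw [← Submodule.Quotient.mk_smul, Ne, Submodule.Quotient.mk_eq_zero]
  simpa using haI

end Representation

/-! ### Character values and scalar action -/

namespace Representation

open scoped MonoidAlgebra

variable {G : Type*} [Group G]

theorem IsIrreducible.ne_zero {n : ℕ} {ρ : Representation ℂ G (Fin n → ℂ)}
    (hρ : ρ.IsIrreducible) : n ≠ 0 := by
  rintro rfl
  obtain ⟨a, b, hab⟩ := hρ.toNontrivial
  exact hab (SetLike.ext fun v ↦ by
    rw [Subsingleton.elim v 0]
    exact iff_of_true a.toSubmodule.zero_mem b.toSubmodule.zero_mem)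

theorem character_fin_one {n : ℕ} (ρ : Representation ℂ G (Fin n → ℂ)) : ρ.character 1 = n := by
  rw [char_one, Module.finrank_fin_fun]

theorem character_of_eq_smul_one {n : ℕ} {ρ : Representation ℂ G (Fin n → ℂ)} {g : G} {c : ℂ}
    (h : ρ g = c • 1) : ρ.character g = ρ.character 1 * c := by
  rw [character_fin_one, character, h, map_smul, LinearMap.trace_one, Module.finrank_fin_fun,
    smul_eq_mul, mul_comm]

section Finite

theorem pow_card_apply {n : ℕ} (ρ : Representation ℂ G (Fin n → ℂ)) (g : G) : ρ g ^ Nat.card G = 1 := by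
  rw [← map_pow, pow_card_eq_one', map_one]

variable [Finite G] {n : ℕ} (ρ : Representation ℂ G (Fin n → ℂ)) (g : G)

theorem norm_character_le : ‖ρ.character g‖ ≤ ‖ρ.character 1‖ := by
  rw [character_fin_one, Complex.norm_natCast]
  simpa [character] using Module.End.norm_trace_le_finrank Nat.card_pos.ne' (ρ.pow_card_apply g)

theorem norm_character_eq_iff : ‖ρ.character g‖ = ‖ρ.character 1‖ ↔ ∃ c : ℂ, ρ g = c • 1 := by
  constructor
  · intro h
    rw [character_fin_one, Complex.norm_natCast] at h
    exact Module.End.eq_smul_one_of_norm_trace_eq Nat.card_pos.ne' (ρ.pow_card_apply g)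
      (by simpa [character] using h)
  · rintro ⟨c, hc⟩
    have h1 := ρ.pow_card_apply g
    rw [hc, smul_pow, one_pow] at h1
    rw [character_of_eq_smul_one hc, norm_mul]
    -- In dimension zero `c` is arbitrary, so it need not be a root of unity.
    rcases Nat.eq_zero_or_pos n with rfl | hn
    · rw [character_fin_one]
      simp
    · have : NeZero n := ⟨hn.ne'⟩
      have h2 : c ^ Nat.card G = 1 := by
        have := congrFun (LinearMap.congr_fun h1 1) 0
        simpa using this
      rw [Complex.norm_eq_one_of_pow_eq_one h2 Nat.card_pos.ne', mul_one]

theorem character_eq_iff : ρ.character g = ρ.character 1 ↔ ρ g = 1 := by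
  constructor
  · intro h
    obtain ⟨c, hc⟩ := (ρ.norm_character_eq_iff g).1 (congrArg _ h)
    rcases Nat.eq_zero_or_pos n with rfl | hn
    · exact Subsingleton.elim _ _
    · have h2 := character_of_eq_smul_one hc
      rw [h, character_fin_one] at h2
      have hn' : (n : ℂ) ≠ 0 := by exact_mod_cast hn.ne'
      rw [hc, mul_left_cancel₀ hn' (h2.symm.trans (mul_one _).symm), one_smul]
  · intro h
    simp [character, h]

end Finite

/-! ### Representations over an invariant linear character -/

section LinearCharacter

variable {N : Subgroup G} [Fintype N] {V : Type*} [AddCommGroup V] [Module ℂ V]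

/-- Up to the factor `|N|⁻¹`, the projection of a representation of `G` to its isotypic component
over the linear character `f` of `N`. -/
def isotypicSum (ρ : Representation ℂ G V) (f : N →* ℂ) : Module.End ℂ V :=
  ∑ n : N, f n⁻¹ • ρ n

theorem apply_mul_isotypicSum (ρ : Representation ℂ G V) (f : N →* ℂ) (m : N) :
    ρ m * isotypicSum ρ f = f m • isotypicSum ρ f := by
  simp only [isotypicSum, Finset.mul_sum, Finset.smul_sum]
  refine Fintype.sum_equiv (Equiv.mulLeft m) _ _ fun n ↦ ?_
  rw [Equiv.coe_mulLeft, mul_inv_rev, smul_smul, mul_smul_comm, Subgroup.coe_mul, ← map_mul ρ,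
    mul_comm, ← map_mul f, inv_mul_cancel_right]

/-- Conjugation by `g` permutes the terms of the sum, and invariance of `f` preserves their
coefficients. -/
theorem commute_isotypicSum [N.Normal] (ρ : Representation ℂ G V) {f : N →* ℂ}
    (hf : ∀ (g : G) (n : N), f (MulAut.conjNormal g n) = f n) (g : G) :
    Commute (isotypicSum ρ f) (ρ g) := by
  simp only [isotypicSum, Commute, SemiconjBy, Finset.mul_sum, Finset.sum_mul]
  symm
  refine Fintype.sum_equiv (MulAut.conjNormal g).toEquiv _ _ fun n ↦ ?_
  simp only [MulEquiv.toEquiv_eq_coe, EquivLike.coe_coe, ← map_inv, hf, MulAut.conjNormal_apply]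
  rw [mul_smul_comm, smul_mul_assoc, ← map_mul, ← map_mul, inv_mul_cancel_right]

/-- By Schur's lemma the isotypic sum is a nonzero scalar; multiplication by `ρ m` scales it by `f
m`. -/
theorem IsIrreducible.apply_eq_smul_of_isotypicSum_ne_zero [N.Normal] [FiniteDimensional ℂ V]
    {ρ : Representation ℂ G V} (hρ : ρ.IsIrreducible) {f : N →* ℂ}
    (hf : ∀ (g : G) (n : N), f (MulAut.conjNormal g n) = f n) (h : isotypicSum ρ f ≠ 0) (m : N) :
    ρ m = f m • 1 := by
  obtain ⟨c, hc⟩ := hρ.exists_eq_smul_one _ (commute_isotypicSum ρ hf)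
  have hc0 : c ≠ 0 := by
    rintro rfl
    exact h (by simpa using hc)
  have := apply_mul_isotypicSum ρ f m
  rw [hc, mul_smul_comm, mul_one, smul_comm] at this
  exact smul_right_injective _ hc0 this

/-- An irreducible representation of `G` lying over the invariant linear character `f` of `N` that
does not kill a given element of the group algebra. -/
theorem exists_isIrreducible_over [Finite G] [N.Normal] {f : N →* ℂ}
    (hf : ∀ (g : G) (n : N), f (MulAut.conjNormal g n) = f n) {a : ℂ[G]}
    (ha : (∑ n : N, MonoidAlgebra.single (n : G) (f n⁻¹)) * a ≠ 0) :
    ∃ (n : ℕ) (ρ : Representation ℂ G (Fin n → ℂ)), ρ.IsIrreducible ∧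
      (∀ m : N, ρ m = f m • 1) ∧ ρ.asAlgebraHom a ≠ 0 := by
  obtain ⟨n, ρ, hρ, h⟩ := exists_isIrreducible_asAlgebraHom_ne_zero ha
  have hs : ρ.asAlgebraHom (∑ n : N, MonoidAlgebra.single (n : G) (f n⁻¹)) = isotypicSum ρ f := by
    simp [isotypicSum, asAlgebraHom_single]
  rw [map_mul, hs] at h
  exact ⟨n, ρ, hρ, hρ.apply_eq_smul_of_isotypicSum_ne_zero hf (left_ne_zero_of_mul h),
    right_ne_zero_of_mul h⟩

end LinearCharacter

end Representation

/-! ### Kernels, commutators and invariant linear characters -/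

namespace CharTable

open Representation

variable {G : Type*} [Group G]

theorem Irr.one_ne_zero (χ : Irr G) : χ.1 1 ≠ 0 := by
  obtain ⟨χ, n, ρ, hρ, rfl⟩ := χ
  simpa [character_fin_one] using hρ.ne_zero

theorem Irr.norm_one (χ : Irr G) : (‖χ.1 1‖ : ℂ) = χ.1 1 := by
  obtain ⟨χ, n, ρ, hρ, rfl⟩ := χ
  simp

theorem Irr.norm_le [Finite G] (χ : Irr G) (g : G) : ‖χ.1 g‖ ≤ ‖χ.1 1‖ := by
  obtain ⟨χ, n, ρ, hρ, rfl⟩ := χ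
  exact ρ.norm_character_le g

/-- The kernel of an irreducible character. -/
def Irr.ker [Finite G] (χ : Irr G) : Subgroup G where
  carrier := {g | χ.1 g = χ.1 1}
  one_mem' := rfl
  mul_mem' := by
    obtain ⟨χ, n, ρ, hρ, rfl⟩ := χ
    intro a b
    simp only [Set.mem_ofPred_eq, character_eq_iff, map_mul]
    rintro ha hb
    rw [ha, hb, one_mul]
  inv_mem' := by
    obtain ⟨χ, n, ρ, hρ, rfl⟩ := χ
    intro a
    simp only [Set.mem_ofPred_eq, character_eq_iff]
    intro ha
    have h := map_mul ρ a⁻¹ a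
    rwa [inv_mul_cancel, map_one, ha, mul_one, eq_comm] at h

theorem Irr.mem_ker [Finite G] {χ : Irr G} {g : G} : g ∈ Irr.ker χ ↔ χ.1 g = χ.1 1 := Iff.rfl

theorem Irr.conj (χ : Irr G) (a b : G) : χ.1 (a * b * a⁻¹) = χ.1 b :=
  (Irr.eq_of_isConj χ _ _ (isConj_iff.2 ⟨a, rfl⟩)).symm

instance Irr.normal_ker [Finite G] (χ : Irr G) : (Irr.ker χ).Normal :=
  ⟨fun b hb a ↦ by rwa [mem_ker, Irr.conj]⟩

/-- A normal subgroup is the intersection of the kernels of the irreducible characters that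
contain it. -/
theorem mem_iff_forall_ker [Finite G] (N : Subgroup G) [N.Normal] (g : G) :
    g ∈ N ↔ ∀ χ : Irr G, N ≤ Irr.ker χ → g ∈ Irr.ker χ := by
  refine ⟨fun hg χ h ↦ h hg, fun h ↦ ?_⟩
  by_contra hg
  have := Fintype.ofFinite N
  -- With `f = 1` and `a = g - 1`, this gives a ρ trivial on `N` but not at `g`. The product is
  -- nonzero because its coefficient at 1 is -1 when `g ∉ N`.
  obtain ⟨n, ρ, hρ, hN, ha⟩ := exists_isIrreducible_over (f := (1 : N →* ℂ))
    (a := MonoidAlgebra.single g 1 - MonoidAlgebra.single 1 1) (fun _ _ ↦ rfl) (by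
      intro h0
      classical
      have h1 := congrArg (fun x ↦ x.coeff 1) h0
      have h2 : ∀ n : N, (n : G) * g ≠ 1 := fun n hn ↦ hg (by
        rw [← inv_eq_of_mul_eq_one_right hn]
        exact N.inv_mem n.2)
      simp [mul_sub, Finset.sum_mul, MonoidAlgebra.single_mul_single, h2, Finsupp.single_apply] at h1)
  have := h ⟨ρ.character, n, ρ, hρ, rfl⟩ fun m hm ↦ (ρ.character_eq_iff m).2 (by
    simpa using hN ⟨m, hm⟩)
  rw [Irr.mem_ker, character_eq_iff] at this
  simp [this] at ha

/-- The commutators of `n` die under ρ iff `ρ n` commutes with the whole image, which by Schur's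
lemma means that it is scalar. -/
theorem commutator_le_ker_iff [Finite G] (N : Subgroup G) (χ : Irr G) :
    ⁅N, (⊤ : Subgroup G)⁆ ≤ Irr.ker χ ↔ ∀ n ∈ N, ‖χ.1 n‖ = ‖χ.1 1‖ := by
  obtain ⟨χ, m, ρ, hρ, rfl⟩ := χ
  simp only [Subgroup.commutator_le, Subgroup.mem_top, forall_const, Irr.mem_ker, character_eq_iff,
    norm_character_eq_iff, commutatorElement_def]
  have key (n g : G) : ρ (n * g * n⁻¹ * g⁻¹) = 1 ↔ Commute (ρ n) (ρ g) := by
    constructor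
    · intro h
      have := congrArg (· * ρ (g * n)) h
      simpa [← map_mul, mul_assoc, Commute, SemiconjBy] using this
    · intro h
      rw [mul_assoc, ← mul_inv_rev, map_mul, map_mul, h.eq, ← map_mul, ← map_mul, mul_inv_cancel,
        map_one]
  simp only [key]
  refine forall₂_congr fun n _ ↦ ⟨hρ.exists_eq_smul_one _, ?_⟩
  rintro ⟨c, hc⟩ g
  rw [hc]
  exact (Commute.one_left _).smul_left c

theorem mem_commutator_iff [Finite G] (N : Subgroup G) [N.Normal] (g : G) :
    g ∈ ⁅N, (⊤ : Subgroup G)⁆ ↔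
      ∀ χ : Irr G, (∀ n ∈ N, ‖χ.1 n‖ = ‖χ.1 1‖) → g ∈ Irr.ker χ := by
  simp only [mem_iff_forall_ker ⁅N, (⊤ : Subgroup G)⁆, commutator_le_ker_iff]

theorem eq_trace_smul_one (f : Module.End ℂ (Fin 1 → ℂ)) :
    f = LinearMap.trace ℂ (Fin 1 → ℂ) f • 1 := by
  have h : f = f 1 0 • 1 := by
    ext i j
    fin_cases i; fin_cases j
    have : (Pi.single 0 1 : Fin 1 → ℂ) = 1 := by ext i; fin_cases i; simp
    simp [this]
  conv_rhs => rw [h]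
  conv_lhs => rw [h]
  simp

theorem irr_and_one_iff {H : Type*} [Group H] (θ : H → ℂ) :
    (θ ∈ Irr H ∧ θ 1 = 1) ↔ ∃ f : H →* ℂ, ⇑f = θ := by
  constructor
  · rintro ⟨⟨n, ρ, hρ, rfl⟩, h1⟩
    obtain rfl : n = 1 := by
      rw [character_fin_one] at h1
      exact_mod_cast h1
    refine ⟨⟨⟨ρ.character, h1⟩, fun a b ↦ ?_⟩, rfl⟩
    change LinearMap.trace ℂ _ (ρ (a * b)) =
      LinearMap.trace ℂ _ (ρ a) * LinearMap.trace ℂ _ (ρ b)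
    conv_lhs => rw [map_mul, eq_trace_smul_one (ρ a), smul_mul_assoc, one_mul, map_smul]
    rfl
  · rintro ⟨f, rfl⟩
    refine ⟨⟨1,
      (DistribMulAction.toModuleEnd ℂ (Fin 1 → ℂ) (S := ℂ)).comp f, ?_, ?_⟩, map_one f⟩
    · have hs : IsSimpleModule ℂ (Fin 1 → ℂ) := by
        rw [isSimpleModule_iff_finrank_eq_one]; simp
      refine { exists_pair_ne := ⟨⊥, ⊤, fun h ↦ ?_⟩, eq_bot_or_eq_top := fun a ↦ ?_ }
      · exact bot_ne_top (α := Submodule ℂ (Fin 1 → ℂ)) (congrArg Subrepresentation.toSubmodule h)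
      · exact (eq_bot_or_eq_top a.toSubmodule).imp
          (fun h ↦ Subrepresentation.toSubmodule_injective h)
          fun h ↦ Subrepresentation.toSubmodule_injective h
    · ext g
      have : ((DistribMulAction.toModuleEnd ℂ (Fin 1 → ℂ) (S := ℂ)).comp f) g =
          f g • 1 := by
        ext; simp
      rw [character, this]
      simp

theorem mem_linInv_iff {N : Subgroup G} [N.Normal] (θ : N → ℂ) :
    θ ∈ LinInv N ↔ ∃ f : N →* ℂ, ⇑f = θ ∧ ∀ (g : G) (n : N), f (MulAut.conjNormal g n) = f n := by
  change θ ∈ Irr N ∧ θ 1 = 1 ∧ _ ↔ _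
  rw [← and_assoc, irr_and_one_iff]
  constructor
  · rintro ⟨⟨f, rfl⟩, h⟩
    exact ⟨f, rfl, h⟩
  · rintro ⟨f, rfl, h⟩
    exact ⟨⟨f, rfl⟩, h⟩

theorem conj_linear_eq {H : Type*} [Group H] [Finite H] (f : H →* ℂ) (h : H) :
    (starRingEnd ℂ) (f h) = f h⁻¹ := by
  have h1 : ‖f h‖ = 1 := Complex.norm_eq_one_of_pow_eq_one
    (by rw [← map_pow, pow_card_eq_one', map_one]) Nat.card_pos.ne'
  rw [← Complex.inv_eq_conj h1, eq_comm]
  exact eq_inv_of_mul_eq_one_left (by rw [← map_mul, inv_mul_cancel, map_one])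

/-- The inner product is `|N|⁻¹` times the trace of the isotypic sum, so if it is nonzero then N
acts through θ. Conversely, the formula makes the inner product `χ(1)`. -/
theorem mem_irrOver_iff [Finite G] {N : Subgroup G} [N.Normal] (θ : LinInv N) (χ : Irr G) :
    χ ∈ irrOver N θ.1 ↔ ∀ n : N, χ.1 n = χ.1 1 * θ.1 n := by
  obtain ⟨θ, hθ⟩ := θ
  obtain ⟨f, rfl, hf⟩ := (mem_linInv_iff θ).1 hθ
  change charInner _ _ ≠ 0 ↔ _
  rw [charInner]
  have := Fintype.ofFinite N
  rw [Subsingleton.elim (Fintype.ofFinite N) this]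
  simp only [conj_linear_eq]
  constructor
  · intro h
    obtain ⟨χ, m, ρ, hρ, rfl⟩ := χ
    have h2 : isotypicSum ρ f ≠ 0 := fun h0 ↦ right_ne_zero_of_mul h (by
      have := congrArg (LinearMap.trace ℂ _) h0
      simpa [isotypicSum, character, mul_comm] using this)
    exact fun n ↦ character_of_eq_smul_one (hρ.apply_eq_smul_of_isotypicSum_ne_zero hf h2 n)
  · intro h
    simp only [h, mul_assoc, ← map_mul, mul_inv_cancel, map_one, mul_one]
    have := Irr.one_ne_zero χ
    simp [this]

theorem irrOver_nonempty [Finite G] {N : Subgroup G} [N.Normal] (θ : LinInv N) :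
    (irrOver N θ.1).Nonempty := by
  obtain ⟨f, hfθ, hf⟩ := (mem_linInv_iff θ.1).1 θ.2
  have := Fintype.ofFinite N
  obtain ⟨n, ρ, hρ, hN, -⟩ := exists_isIrreducible_over (a := 1) hf (by
    intro h0
    classical
    have h1 := congrArg (fun x ↦ x.coeff 1) h0
    simp [Finsupp.single_apply] at h1)
  refine ⟨⟨ρ.character, n, ρ, hρ, rfl⟩, (mem_irrOver_iff θ _).2 fun m ↦ ?_⟩
  rw [← hfθ]
  exact character_of_eq_smul_one (hN m)

/-- If a normal subgroup `N` acts by scalars in the representation affording `χ`, then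
`χ` lies over an invariant linear character of `N`. -/
theorem exists_linInv_of_norm_eq [Finite G] {N : Subgroup G} [N.Normal] {χ : Irr G}
    (h : ∀ n ∈ N, ‖χ.1 n‖ = ‖χ.1 1‖) : ∃ θ : LinInv N, ∀ n : N, χ.1 n = χ.1 1 * θ.1 n := by
  have h1 := Irr.one_ne_zero χ
  have hinv := Irr.conj χ
  obtain ⟨χ, m, ρ, hρ, rfl⟩ := χ
  simp only [norm_character_eq_iff] at h h1 hinv ⊢
  choose! c hc using h
  have hχ (n : N) : ρ.character n = ρ.character 1 * c n := character_of_eq_smul_one (hc n n.2)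
  have hmul (a b : N) : c (a * b) = c a * c b := by
    refine mul_left_cancel₀ h1 ?_
    rw [← Subgroup.coe_mul, ← hχ]
    exact character_of_eq_smul_one (by
      rw [Subgroup.coe_mul, map_mul, hc a a.2, hc b b.2, smul_mul_smul_comm, one_mul])
  have hone : c 1 = 1 := mul_left_cancel₀ h1 (by simpa using (hχ 1).symm)
  refine ⟨⟨fun n ↦ c n, (mem_linInv_iff _).2 ⟨⟨⟨fun n ↦ c n, hone⟩, hmul⟩, rfl, fun g n ↦ ?_⟩⟩, hχ⟩
  refine mul_left_cancel₀ h1 ?_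
  change _ * c (MulAut.conjNormal g n) = _ * c n
  rw [← hχ, ← hχ, MulAut.conjNormal_apply, hinv]

theorem norm_linInv [Finite G] {N : Subgroup G} [N.Normal] (θ : LinInv N) (n : N) :
    ‖θ.1 n‖ = 1 := by
  obtain ⟨f, hfθ, -⟩ := (mem_linInv_iff θ.1).1 θ.2
  rw [← hfθ]
  exact Complex.norm_eq_one_of_pow_eq_one
    (by rw [← map_pow, pow_card_eq_one', map_one]) Nat.card_pos.ne'

end CharTable

/-! ### Central series -/

namespace CharTable

open scoped commutatorElement

variable {G G' : Type*} [Group G] [Group G']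

theorem mem_upperSeries_succ (N : Subgroup G) [N.Normal] (i : ℕ) (x : G) :
    x ∈ upperSeries N (i + 1) ↔ (∀ g : G, ⁅x, g⁆ ∈ upperSeries N i) ∧ x ∈ N := by
  have := (upperSeriesAux N i).2
  change x ∈ (Subgroup.center (G ⧸ (upperSeriesAux N i).1)).comap
    (QuotientGroup.mk' (upperSeriesAux N i).1) ⊓ N ↔ _
  rw [Subgroup.mem_inf, Subgroup.mem_comap, Subgroup.mem_center_iff]
  refine and_congr_left fun _ ↦ ?_
  rw [(QuotientGroup.mk'_surjective (upperSeriesAux N i).1).forall]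
  refine forall_congr' fun g ↦ ?_
  rw [← map_mul, ← map_mul, eq_comm, ← mul_inv_eq_one, ← map_inv, ← map_mul]
  change ((x * g * (g * x)⁻¹ : G) : G ⧸ (upperSeriesAux N i).1) = 1 ↔ _
  rw [QuotientGroup.eq_one_iff, commutatorElement_def, mul_inv_rev, ← mul_assoc]
  rfl

/-- This describes each term through inclusion and `[·,G]` only, which is what a table equivalence
preserves. -/
theorem le_upperSeries_succ (N : Subgroup G) [N.Normal] (i : ℕ) (L : Subgroup G) :
    L ≤ upperSeries N (i + 1) ↔ ⁅L, (⊤ : Subgroup G)⁆ ≤ upperSeries N i ∧ L ≤ N := by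
  rw [Subgroup.commutator_le]
  simp only [SetLike.le_def, mem_upperSeries_succ, Subgroup.mem_top, forall_const]
  exact ⟨fun h ↦ ⟨fun x hx ↦ (h hx).1, fun x hx ↦ (h hx).2⟩, fun h x hx ↦ ⟨h.1 x hx, h.2 hx⟩⟩

instance normal_upperSeries (N : Subgroup G) [N.Normal] (i : ℕ) : (upperSeries N i).Normal :=
  (upperSeriesAux N i).2

theorem monotone_upperSeries (N : Subgroup G) [N.Normal] : Monotone (upperSeries N) := by
  refine monotone_nat_of_le_succ fun i ↦ ?_
  induction i with
  | zero => exact bot_le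
  | succ i ih =>
    rw [le_upperSeries_succ]
    obtain ⟨h, h'⟩ := (le_upperSeries_succ N i _).1 le_rfl
    exact ⟨h.trans ih, h'⟩

theorem mem_hypercentre (N : Subgroup G) [N.Normal] (x : G) :
    x ∈ hypercentre N ↔ ∃ i, x ∈ upperSeries N i :=
  Subgroup.mem_iSup_of_directed (monotone_upperSeries N).directed_le

instance normal_lowerSeries (N : Subgroup G) [N.Normal] (i : ℕ) : (lowerSeries N i).Normal := by
  induction i with
  | zero => assumption
  | succ i ih => exact Subgroup.commutator_normal _ _

/-! ### Transport of normal subgroups -/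

namespace TableEquiv

/-- The inverse of an equivalence of character tables. -/
def symm (T : TableEquiv G G') : TableEquiv G' G where
  row := T.row.symm
  col := T.col.symm
  entry_eq χ c := by
    rw [← T.entry_eq, Equiv.apply_symm_apply, Equiv.apply_symm_apply]

/-- The classes of `g` and `g'` index matching columns. -/
def Matches (T : TableEquiv G G') (g : G) (g' : G') : Prop :=
  T.col (ConjClasses.mk g) = ConjClasses.mk g'

variable (T : TableEquiv G G')

theorem matches_symm {g : G} {g' : G'} : T.symm.Matches g' g ↔ T.Matches g g' := by
  simp only [Matches, symm]
  rw [Equiv.symm_apply_eq, eq_comm]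

theorem exists_matches_right (g : G) : ∃ g', T.Matches g g' :=
  (ConjClasses.exists_rep (T.col (ConjClasses.mk g))).imp fun _ h ↦ h.symm

theorem exists_matches_left (g' : G') : ∃ g, T.Matches g g' :=
  (T.symm.exists_matches_right g').imp fun _ h ↦ T.matches_symm.1 h

variable {T}

theorem Matches.row_apply {g : G} {g' : G'} (h : T.Matches g g') (χ : Irr G) :
    (T.row χ).1 g' = χ.1 g := by
  have h1 := T.entry_eq χ (ConjClasses.mk g)
  rw [show T.col (ConjClasses.mk g) = ConjClasses.mk g' from h] at h1
  exact h1

theorem Matches.isConj {g : G} {h : G} {g' : G'} (hg : T.Matches g g') (hh : T.Matches h g') :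
    IsConj g h :=
  ConjClasses.mk_eq_mk_iff_isConj.1 (T.col.injective (Eq.trans hg (Eq.symm hh)))

theorem Matches.mem_iff {M : Subgroup G} [M.Normal] {g h : G} {g' : G'} (hg : T.Matches g g')
    (hh : T.Matches h g') : g ∈ M ↔ h ∈ M := by
  obtain ⟨c, rfl⟩ := isConj_iff.1 (hg.isConj hh)
  rw [Subgroup.Normal.mem_comm_iff ‹_› (a := c * g), inv_mul_cancel_left]

theorem mem_transport {M : Subgroup G} [M.Normal] {g : G} {g' : G'} (h : T.Matches g g') :
    g' ∈ T.transport (M : Set G) ↔ g ∈ M :=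
  ⟨fun ⟨_, ha, hag⟩ ↦ (Matches.mem_iff hag h).1 ha, fun hg ↦ ⟨g, hg, h⟩⟩

variable [Finite G] [Finite G']

variable (T) in
-- Degrees are the largest absolute values in their rows. Comparing the columns of both identities
-- in both directions shows that the match `c` of 1 lies in every kernel, so `c = 1`.
theorem matches_one : T.Matches 1 1 := by
  obtain ⟨c, hc⟩ := T.exists_matches_right 1
  obtain ⟨d, hd⟩ := T.exists_matches_left 1
  suffices c ∈ (⊥ : Subgroup G') by rwa [Subgroup.mem_bot.1 this] at hc
  rw [mem_iff_forall_ker]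
  intro χ' _
  obtain ⟨χ, rfl⟩ := T.row.surjective χ'
  have h1 := hc.row_apply χ
  have h2 := hd.row_apply χ
  rw [Irr.mem_ker]
  have h3 := Irr.norm_le χ d
  have h4 := Irr.norm_le (T.row χ) c
  rw [← h1, ← h2] at h3
  have h5 := Irr.norm_one (T.row χ)
  have h6 := Irr.norm_one χ
  rw [← h1] at h6
  rw [← h5, ← h6, h4.antisymm h3]

variable (T) in
theorem row_one (χ : Irr G) : (T.row χ).1 1 = χ.1 1 := T.matches_one.row_apply χ

theorem Matches.mem_ker_iff {g : G} {g' : G'} (h : T.Matches g g') (χ : Irr G) :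
    g' ∈ Irr.ker (T.row χ) ↔ g ∈ Irr.ker χ := by
  rw [Irr.mem_ker, Irr.mem_ker, h.row_apply, T.row_one]

variable (T)

/-- The normal subgroup of `G'` that matches a normal subgroup of `G`. -/
def map (M : Subgroup G) : Subgroup G' := ⨅ (χ : Irr G) (_ : M ≤ Irr.ker χ), Irr.ker (T.row χ)

instance normal_map (M : Subgroup G) : (T.map M).Normal :=
  Subgroup.normal_iInf_normal fun _ ↦ Subgroup.normal_iInf_normal fun _ ↦ Irr.normal_ker _

variable {T} in
theorem Matches.mem_map_iff {M : Subgroup G} [M.Normal] {g : G} {g' : G'} (h : T.Matches g g') :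
    g' ∈ T.map M ↔ g ∈ M := by
  simp only [map, Subgroup.mem_iInf, h.mem_ker_iff, ← mem_iff_forall_ker]

theorem coe_map (M : Subgroup G) [M.Normal] : (T.map M : Set G') = T.transport (M : Set G) := by
  ext g'
  obtain ⟨g, hg⟩ := T.exists_matches_left g'
  rw [mem_transport hg, SetLike.mem_coe, hg.mem_map_iff]

theorem map_le_map_iff {M L : Subgroup G} [M.Normal] [L.Normal] :
    T.map M ≤ T.map L ↔ M ≤ L := by
  constructor
  · intro h g hg
    obtain ⟨g', h'⟩ := T.exists_matches_right g
    exact h'.mem_map_iff.1 (h (h'.mem_map_iff.2 hg))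
  · intro h g' hg'
    obtain ⟨g, h'⟩ := T.exists_matches_left g'
    exact h'.mem_map_iff.2 (h (h'.mem_map_iff.1 hg'))

theorem map_symm_map (L : Subgroup G') [L.Normal] : T.map (T.symm.map L) = L := by
  ext g'
  obtain ⟨g, h⟩ := T.exists_matches_left g'
  rw [h.mem_map_iff, (T.matches_symm.2 h).mem_map_iff]

theorem map_bot : T.map ⊥ = ⊥ := by
  refine le_bot_iff.1 ?_
  rw [← T.map_symm_map ⊥, map_le_map_iff]
  exact bot_le

theorem forall_mem_map_norm_iff {M : Subgroup G} [M.Normal] (χ : Irr G) :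
    (∀ n ∈ T.map M, ‖(T.row χ).1 n‖ = ‖(T.row χ).1 1‖) ↔ ∀ n ∈ M, ‖χ.1 n‖ = ‖χ.1 1‖ := by
  rw [T.row_one]
  constructor
  · intro h g hg
    obtain ⟨g', h'⟩ := T.exists_matches_right g
    rw [← h'.row_apply, h g' (h'.mem_map_iff.2 hg)]
  · intro h g' hg'
    obtain ⟨g, h'⟩ := T.exists_matches_left g'
    rw [h'.row_apply, h g (h'.mem_map_iff.1 hg')]

theorem map_commutator (M : Subgroup G) [M.Normal] :
    T.map ⁅M, (⊤ : Subgroup G)⁆ = ⁅T.map M, (⊤ : Subgroup G')⁆ := by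
  ext g'
  obtain ⟨g, h⟩ := T.exists_matches_left g'
  rw [h.mem_map_iff, mem_commutator_iff, mem_commutator_iff, T.row.surjective.forall]
  simp only [forall_mem_map_norm_iff, h.mem_ker_iff]

theorem map_lowerSeries (N : Subgroup G) [N.Normal] (i : ℕ) :
    T.map (lowerSeries N i) = lowerSeries (T.map N) i := by
  induction i with
  | zero => rfl
  | succ i ih => rw [lowerSeries, lowerSeries, map_commutator, ih]

theorem map_upperSeries (N : Subgroup G) [N.Normal] (i : ℕ) :
    T.map (upperSeries N i) = upperSeries (T.map N) i := by
  induction i with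
  | zero => exact T.map_bot
  | succ i ih =>
    refine le_antisymm ?_ ?_
    · rw [le_upperSeries_succ, ← map_commutator, ← ih, map_le_map_iff, map_le_map_iff,
        ← le_upperSeries_succ]
    -- Every normal subgroup of `G'` is an image under `T.map`, so the inclusion can be tested on
    -- its preimage in `G`.
    · rw [← T.map_symm_map (upperSeries (T.map N) (i + 1)), map_le_map_iff, le_upperSeries_succ,
        ← T.map_le_map_iff, ← T.map_le_map_iff, map_commutator, map_symm_map, ih,
        ← le_upperSeries_succ]

theorem map_hypercentre (N : Subgroup G) [N.Normal] :
    (hypercentre (T.map N) : Set G') = T.transport (hypercentre N : Set G) := by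
  ext g'
  rw [SetLike.mem_coe, mem_hypercentre]
  simp only [← map_upperSeries]
  constructor
  · rintro ⟨i, hi⟩
    obtain ⟨g, h⟩ := T.exists_matches_left g'
    exact ⟨g, (mem_hypercentre N g).2 ⟨i, h.mem_map_iff.1 hi⟩, h⟩
  · rintro ⟨g, hg, h⟩
    exact ((mem_hypercentre N g).1 hg).imp fun i hi ↦ Matches.mem_map_iff h |>.2 hi

theorem isHypercentral_map_iff (N : Subgroup G) [N.Normal] :
    IsHypercentral (T.map N) ↔ IsHypercentral N := by
  refine exists_congr fun r ↦ ?_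
  rw [← map_lowerSeries, ← le_bot_iff, ← T.map_bot, map_le_map_iff, le_bot_iff]

/-! ### Matching of invariant linear characters -/

/-- Invariant linear characters of `N` and of `T.map N` that take the same values on matching
elements. -/
def LinMatches {N : Subgroup G} [N.Normal] (θ : LinInv N) (θ' : LinInv (T.map N)) : Prop :=
  ∀ (n : N) (n' : T.map N), T.Matches n n' → θ'.1 n' = θ.1 n

variable {T} {N : Subgroup G} [N.Normal]

/-- Invariant linear characters match when they lie under matching irreducible characters. -/
theorem linMatches_of_mem_irrOver {θ : LinInv N} {θ' : LinInv (T.map N)} {χ : Irr G}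
    (h : χ ∈ irrOver N θ.1) (h' : T.row χ ∈ irrOver (T.map N) θ'.1) : T.LinMatches θ θ' := by
  rw [mem_irrOver_iff] at h h'
  intro n n' hn
  refine mul_left_cancel₀ (Irr.one_ne_zero χ) ?_
  rw [← h, ← T.row_one, ← h', hn.row_apply]

theorem LinMatches.row_mem_irrOver_iff {θ : LinInv N} {θ' : LinInv (T.map N)}
    (h : T.LinMatches θ θ') (χ : Irr G) :
    T.row χ ∈ irrOver (T.map N) θ'.1 ↔ χ ∈ irrOver N θ.1 := by
  rw [mem_irrOver_iff, mem_irrOver_iff, T.row_one]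
  constructor
  · rintro h1 ⟨n, hn⟩
    obtain ⟨n', hn'⟩ := T.exists_matches_right n
    have := h1 ⟨n', hn'.mem_map_iff.2 hn⟩
    rwa [h ⟨n, hn⟩ _ hn', hn'.row_apply] at this
  · rintro h1 ⟨n', hm⟩
    obtain ⟨n, hn⟩ := T.exists_matches_left n'
    have := h1 ⟨n, hn.mem_map_iff.1 hm⟩
    rwa [← h _ ⟨n', hm⟩ hn, ← hn.row_apply] at this

theorem norm_eq_of_mem_irrOver {θ : LinInv N} {χ : Irr G} (h : χ ∈ irrOver N θ.1) (n : G)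
    (hn : n ∈ N) : ‖χ.1 n‖ = ‖χ.1 1‖ := by
  rw [(mem_irrOver_iff θ χ).1 h ⟨n, hn⟩, norm_mul, norm_linInv, mul_one]

variable (T) in
-- Pick χ over θ. Since `|χ| = χ(1)` on N, the matching row has the same property on `T.map N`, so
-- it lies over some θ'.
theorem exists_linMatches_right (θ : LinInv N) : ∃ θ', T.LinMatches θ θ' := by
  obtain ⟨χ, hχ⟩ := irrOver_nonempty θ
  obtain ⟨θ', h⟩ := exists_linInv_of_norm_eq
    ((T.forall_mem_map_norm_iff χ).2 (norm_eq_of_mem_irrOver hχ))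
  exact ⟨θ', linMatches_of_mem_irrOver hχ ((mem_irrOver_iff _ _).2 h)⟩

theorem exists_linMatches_left (θ' : LinInv (T.map N)) : ∃ θ : LinInv N, T.LinMatches θ θ' := by
  obtain ⟨χ', hχ⟩ := irrOver_nonempty θ'
  obtain ⟨χ, rfl⟩ := T.row.surjective χ'
  obtain ⟨θ, h⟩ := exists_linInv_of_norm_eq
    ((T.forall_mem_map_norm_iff χ).1 (norm_eq_of_mem_irrOver hχ))
  exact ⟨θ, linMatches_of_mem_irrOver ((mem_irrOver_iff _ _).2 h) hχ⟩

theorem LinMatches.left_unique {θ₁ θ₂ : LinInv N} {θ' : LinInv (T.map N)}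
    (h₁ : T.LinMatches θ₁ θ') (h₂ : T.LinMatches θ₂ θ') : θ₁ = θ₂ := by
  refine Subtype.ext (funext fun n ↦ ?_)
  obtain ⟨n', hn⟩ := T.exists_matches_right (n : G)
  rw [← h₁ n ⟨n', hn.mem_map_iff.2 n.2⟩ hn, h₂ n ⟨n', hn.mem_map_iff.2 n.2⟩ hn]

theorem LinMatches.right_unique {θ : LinInv N} {θ₁ θ₂ : LinInv (T.map N)}
    (h₁ : T.LinMatches θ θ₁) (h₂ : T.LinMatches θ θ₂) : θ₁ = θ₂ := by
  refine Subtype.ext (funext fun n' ↦ ?_)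
  obtain ⟨n, hn⟩ := T.exists_matches_left (n' : G')
  rw [h₁ ⟨n, hn.mem_map_iff.1 n'.2⟩ n' hn, h₂ ⟨n, hn.mem_map_iff.1 n'.2⟩ n' hn]

variable (T N) in
theorem exists_equiv_linMatches : ∃ τ : LinInv N ≃ LinInv (T.map N), ∀ θ, T.LinMatches θ (τ θ) := by
  choose τ hτ using T.exists_linMatches_right (N := N)
  refine ⟨Equiv.ofBijective τ ⟨fun a b hab ↦ ?_, fun θ' ↦ ?_⟩, hτ⟩
  · exact (hτ a).left_unique (hab ▸ hτ b)
  · obtain ⟨θ, h⟩ := exists_linMatches_left θ'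
    exact ⟨θ, (hτ θ).right_unique h⟩

end TableEquiv

end CharTable

theorem corollary3p3 {G G' : Type*} [Group G] [Finite G] [Group G'] [Finite G']
    (T : CharTable.TableEquiv G G') (N : Subgroup G) [N.Normal] :
    ∃ (N' : Subgroup G') (_ : N'.Normal), (N' : Set G') = T.transport (N : Set G) ∧
      ((⁅N', (⊤ : Subgroup G')⁆ : Subgroup G') : Set G') =
        T.transport ((⁅N, (⊤ : Subgroup G)⁆ : Subgroup G) : Set G) ∧
      (∃ τ : CharTable.LinInv N ≃ CharTable.LinInv N', ∀ θ : CharTable.LinInv N,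
        T.row '' CharTable.irrOver N θ.1 = CharTable.irrOver N' (τ θ).1) ∧
      (CharTable.hypercentre N' : Set G') = T.transport (CharTable.hypercentre N : Set G) ∧
      (CharTable.IsHypercentral N ↔ CharTable.IsHypercentral N') ∧
      (CharTable.IsHypercentral N → ∀ i : ℕ, (CharTable.lowerSeries N' i : Set G') =
        T.transport (CharTable.lowerSeries N i : Set G)) := by
  obtain ⟨τ, hτ⟩ := T.exists_equiv_linMatches N
  refine ⟨T.map N, inferInstance, T.coe_map N, ?_, ⟨τ, fun θ ↦ ?_⟩, T.map_hypercentre N,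
    (T.isHypercentral_map_iff N).symm, fun _ i ↦ ?_⟩
  · rw [← T.map_commutator, T.coe_map]
  · ext χ'
    obtain ⟨χ, rfl⟩ := T.row.surjective χ'
    rw [T.row.injective.mem_set_image, (hτ θ).row_mem_irrOver_iff]
  · rw [← T.map_lowerSeries, T.coe_map]
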